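/- Let $A$ be a random variable with probability density $$f_A(x)=\frac{x^{a}}{b^{a+1}\Gamma(a+1)}\,e^{-x/b}\quad (x>0),\qquad f_A(x)=0\quad (x\le 0),$$ where $a>-1$ is not an integer and $b>0$, and let $\rho_t>0$. Then $\log_2(1+\rho_t A^2)$ is integrable and the ergodic capacity $C=\mathbb{E}\left[\log_2\left(1+\rho_t A^2\right)\right]$ is $$\begin{aligned} C={}&\frac{a^2-a}{(a-1)_2}\log_2\left(b^2\rho_t\right)+\frac{2\left(a^2-a\right)}{\ln(2)\,(a-1)_2}F_0(1+a) +\frac{\pi\csc\left(\frac{a\pi}{2}\right)\,{}_1F_2\left(1+\frac a2;\frac32,2+\frac a2;-\frac1{4b^2\rho_t}\right)}{\ln(2)\,(2+a)\,b^{a+2}\,\Gamma(a+1)\,\rho_t^{\frac a2+1}}\\ &+\frac{\pi\sec\left(\frac{a\pi}{2}\right)\,{}_1F_2\left(\frac{a+1}2;\frac12,\frac{a+3}2;-\frac1{4b^2\rho_t}\right)}{(a+1)\,b^{a+1}\ln(2)\,\Gamma(a+1)\,\rho_t^{\frac{a+1}2}} +\frac{{}_2F_3\left(1,1;2,1-\frac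 a2,\frac{3-a}2;-\frac1{4b^2\rho_t}\right)}{\ln(2)\,(a-1)_2\,b^2\rho_t}, \end{aligned}$$ where $(x)_n=x(x+1)\cdots(x+n-1)$ is the Pochhammer symbol, $F_0=\Gamma'/\Gamma$ is the digamma function (the polygamma function of order zero), and ${}_pF_q$ is the generalized hypergeometric series. In particular, for a wireless system assisted by a reconfigurable intelligent surface with $N\ge 1$ reflection units, where $$a=\frac{k_1^2}{k_2}-1,\qquad b=\frac{k_2}{k_1},\qquad k_1=\frac{N\pi}{2},\qquad k_2=4N\left(1-\frac{\pi^2}{16}\right),$$ and $\rho_t=P_t/N_o$ with transmission power $P_t>0$ and noise variance $N_o>0$, the number $a$ is never an integer, and if $A$ has the density $f_A$ above with these $a$ and $b$, then its ergodic capacity is given by this formula. -/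

import Mathlib

open MeasureTheory

namespace RIS

noncomputable section

/-- The Pochhammer symbol `(x)_n = x (x + 1) ⋯ (x + n - 1)`. -/
def poch (x : ℝ) (n : ℕ) : ℝ := (ascPochhammer ℝ n).eval x

/-- The generalized hypergeometric series `pFq(as; bs; z)`. -/
def pFq (as bs : List ℝ) (z : ℝ) : ℝ :=
  ∑' n : ℕ, (as.map fun c => poch c n).prod / (bs.map fun c => poch c n).prod
    * (z ^ n / (n.factorial : ℝ))

/-- Cosecant. -/
def csc (x : ℝ) : ℝ := 1 / Real.sin x

/-- Secant. -/
def sec (x : ℝ) : ℝ := 1 / Real.cos x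

/-- The digamma function (polygamma function of order zero) at a real argument. -/
def digamma (x : ℝ) : ℝ := (Complex.digamma (x : ℂ)).re

/-- The Gamma-type density of the end-to-end channel coefficient, supported on `(0, ∞)`. -/
def channelPDF (a b x : ℝ) : ℝ :=
  if 0 < x then x ^ a / (b ^ (a + 1) * Real.Gamma (a + 1)) * Real.exp (-x / b) else 0

/-- The random variable `A` has the density `channelPDF a b` with respect to Lebesgue measure. -/
def HasChannelPDF {Ω : Type*} [MeasurableSpace Ω] (P : Measure Ω) (A : Ω → ℝ) (a b : ℝ) : Prop :=
  AEMeasurable A P ∧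
    P.map A = (volume : Measure ℝ).withDensity fun x => ENNReal.ofReal (channelPDF a b x)

/-- The instantaneous rate `log₂(1 + ρ A²)`. -/
def rate {Ω : Type*} (ρ : ℝ) (A : Ω → ℝ) (ω : Ω) : ℝ := Real.logb 2 (1 + ρ * A ω ^ 2)

/-- The ergodic capacity `E[log₂(1 + ρ A²)]`. -/
def ergodicCapacity {Ω : Type*} [MeasurableSpace Ω] (P : Measure Ω) (ρ : ℝ) (A : Ω → ℝ) : ℝ :=
  ∫ ω, rate ρ A ω ∂P

/-- The closed form of the ergodic capacity. -/
def capacityFormula (a b ρ : ℝ) : ℝ :=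
  (a ^ 2 - a) / poch (a - 1) 2 * Real.logb 2 (b ^ 2 * ρ)
  + 2 * (a ^ 2 - a) / (Real.log 2 * poch (a - 1) 2) * digamma (1 + a)
  + Real.pi * csc (a * Real.pi / 2)
      * pFq [1 + a / 2] [3 / 2, 2 + a / 2] (-(1 / (4 * b ^ 2 * ρ)))
      / (Real.log 2 * (2 + a) * b ^ (a + 2) * Real.Gamma (a + 1) * ρ ^ (a / 2 + 1))
  + Real.pi * sec (a * Real.pi / 2)
      * pFq [(a + 1) / 2] [1 / 2, (a + 3) / 2] (-(1 / (4 * b ^ 2 * ρ)))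
      / ((a + 1) * b ^ (a + 1) * Real.log 2 * Real.Gamma (a + 1) * ρ ^ ((a + 1) / 2))
  + pFq [1, 1] [2, 1 - a / 2, (3 - a) / 2] (-(1 / (4 * b ^ 2 * ρ)))
      / (Real.log 2 * poch (a - 1) 2 * b ^ 2 * ρ)

/-- `k₁ = N π / 2`. -/
def k₁ (N : ℕ) : ℝ := N * Real.pi / 2

/-- `k₂ = 4 N (1 - π² / 16)`. -/
def k₂ (N : ℕ) : ℝ := 4 * N * (1 - Real.pi ^ 2 / 16)

/-- The shape parameter `a = k₁² / k₂ - 1` of a system with `N` reflection units. -/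
def shape (N : ℕ) : ℝ := k₁ N ^ 2 / k₂ N - 1

/-- The scale parameter `b = k₂ / k₁` of a system with `N` reflection units. -/
def scale (N : ℕ) : ℝ := k₂ N / k₁ N

end

end RIS

/-!
The capacity is reduced to a one-parameter integral, and that integral is identified by an ordinary
differential equation.

Substituting `x = b y` and putting `w = 1 / (b √ρ)` turns `Γ(a+1) log 2` times the capacity into
`Γ(a+1) log (b² ρ) + G(w)` with `G(w) = ∫₀^∞ x^a e^(-x) log (w² + x²) dx` (`logIntegral`). Here
`G(0+) = 2 Γ'(a+1)`, which gives the digamma term, and `G'(w) = 2 w^a H(w)`, where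
`H(w) = ∫₀^∞ y^a e^(-w y) / (1 + y²) dy` (`laplaceKernel`).

For non-integer `a > -1`,
`H(w) = (π/2) (csc (aπ/2) sin w + sec (aπ/2) cos w) + ∑ (-1)ⁿ Γ(a-1-2n) w^(2n+1-a)`
(`laplaceKernel_eq`). Indeed both sides solve `y'' + y = Γ(a+1) w^(-a-1)`. If `-1 < a < 0`, both
sides and their derivatives have the same limits at `0`, by the evaluation of `∫₀^∞ y^a / (1 + y²) dy`
for `|a| < 1`, so they agree. Differentiation in `w` replaces `a` by `a + 1` and changes the sign
on both sides, which gives all larger `a`.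

Integrating `2 w^a H(w)` term by term from `0` yields three series (`logIntegral_eq`), and these are
the `₁F₂`, `₁F₂` and `₂F₃` of the closed form once their Pochhammer symbols are rewritten through
factorials and Gamma values (`pFq_sin`, `pFq_cos`, `pFq_gamma`).

For the system with `N` units the shape is `N π² / (16 - π²) - 1`, so it cannot be an integer because
`π²` is irrational (`irrational_pi_sq`). The proof of that is Cartwright's: at `π / 2` the recursion
for `∫₋₁¹ (1 - x²)ⁿ cos (π x / 2) dx` involves `π` only through `π²`.
-/

namespace RIS

section

open Real Filter Topology Set

/-! ### Irrationality of `π²` and the shape parameter -/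

/-- Cartwright's integral at the point `π / 2`, where the boundary terms of its recursion vanish. -/
noncomputable def cartwright (n : ℕ) : ℝ := ∫ x in (-1 : ℝ)..1, (1 - x ^ 2) ^ n * cos (x * (π / 2))

lemma cartwright_zero : cartwright 0 * (π / 2) = 2 := by
  have h : ∫ x in (-1 : ℝ)..1, cos (x * (π / 2)) * (π / 2)
      = sin (1 * (π / 2)) - sin (-1 * (π / 2)) :=
    intervalIntegral.integral_eq_sub_of_hasDerivAt
      (fun x _ => (hasDerivAt_mul_const (π / 2)).sin)
      (Continuous.intervalIntegrable (by fun_prop) _ _)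
  rw [intervalIntegral.integral_mul_const] at h
  simp only [cartwright, pow_zero, one_mul]
  rw [h]
  simp
  norm_num

lemma cartwright_one : cartwright 1 * (π / 2) ^ 2 = 2 * cartwright 0 := by
  have hd (x : ℝ) : HasDerivAt
      (fun x : ℝ => (π / 2) * (1 - x ^ 2) * sin (x * (π / 2)) - 2 * x * cos (x * (π / 2)))
      ((1 - x ^ 2) ^ 1 * cos (x * (π / 2)) * (π / 2) ^ 2
        - 2 * ((1 - x ^ 2) ^ 0 * cos (x * (π / 2)))) x := by
    have h1 : HasDerivAt (fun x : ℝ => 1 - x ^ 2) (-(2 * x)) x := by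
      simpa using (hasDerivAt_pow 2 x).const_sub 1
    have hs : HasDerivAt (fun x : ℝ => sin (x * (π / 2))) (cos (x * (π / 2)) * (π / 2)) x :=
      (hasDerivAt_mul_const (π / 2)).sin
    have hc : HasDerivAt (fun x : ℝ => cos (x * (π / 2))) (-sin (x * (π / 2)) * (π / 2)) x :=
      (hasDerivAt_mul_const (π / 2)).cos
    refine (((h1.const_mul (π / 2)).fun_mul hs).fun_sub
      (((hasDerivAt_id' x).const_mul 2).fun_mul hc)).congr_deriv ?_
    ring
  have h := intervalIntegral.integral_eq_sub_of_hasDerivAt (a := -1) (b := 1) (fun x _ => hd x)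
    (Continuous.intervalIntegrable (by fun_prop) _ _)
  rw [intervalIntegral.integral_sub (Continuous.intervalIntegrable (by fun_prop) _ _)
    (Continuous.intervalIntegrable (by fun_prop) _ _), intervalIntegral.integral_mul_const,
    intervalIntegral.integral_const_mul] at h
  simp at h
  simp only [cartwright]
  simp
  linarith

lemma cartwright_add_two (n : ℕ) : cartwright (n + 2) * (π / 2) ^ 2
    = 2 * (n + 2) * (2 * n + 3) * cartwright (n + 1) - 4 * (n + 2) * (n + 1) * cartwright n := by
  have hd (x : ℝ) : HasDerivAt (fun x : ℝ => (π / 2) * (1 - x ^ 2) ^ (n + 2) * sin (x * (π / 2))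
        - 2 * (n + 2) * x * (1 - x ^ 2) ^ (n + 1) * cos (x * (π / 2)))
      ((1 - x ^ 2) ^ (n + 2) * cos (x * (π / 2)) * (π / 2) ^ 2
        - 2 * (n + 2) * (2 * n + 3) * ((1 - x ^ 2) ^ (n + 1) * cos (x * (π / 2)))
        + 4 * (n + 2) * (n + 1) * ((1 - x ^ 2) ^ n * cos (x * (π / 2)))) x := by
    have h1 : HasDerivAt (fun x : ℝ => 1 - x ^ 2) (-(2 * x)) x := by
      simpa using (hasDerivAt_pow 2 x).const_sub 1
    have hs : HasDerivAt (fun x : ℝ => sin (x * (π / 2))) (cos (x * (π / 2)) * (π / 2)) x :=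
      (hasDerivAt_mul_const (π / 2)).sin
    have hc : HasDerivAt (fun x : ℝ => cos (x * (π / 2))) (-sin (x * (π / 2)) * (π / 2)) x :=
      (hasDerivAt_mul_const (π / 2)).cos
    refine ((((h1.fun_pow (n + 2)).const_mul (π / 2)).fun_mul hs).fun_sub
      ((((hasDerivAt_id' x).const_mul (2 * ((n : ℝ) + 2))).fun_mul
        (h1.fun_pow (n + 1))).fun_mul hc)).congr_deriv ?_
    push_cast
    ring
  have h := intervalIntegral.integral_eq_sub_of_hasDerivAt (a := -1) (b := 1) (fun x _ => hd x)
    (Continuous.intervalIntegrable (by fun_prop) _ _)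
  rw [intervalIntegral.integral_add (Continuous.intervalIntegrable (by fun_prop) _ _)
    (Continuous.intervalIntegrable (by fun_prop) _ _),
    intervalIntegral.integral_sub (Continuous.intervalIntegrable (by fun_prop) _ _)
    (Continuous.intervalIntegrable (by fun_prop) _ _), intervalIntegral.integral_mul_const,
    intervalIntegral.integral_const_mul, intervalIntegral.integral_const_mul] at h
  simp at h
  simp only [cartwright]
  linarith

lemma cartwright_pos (n : ℕ) : 0 < cartwright n := by
  refine intervalIntegral.integral_pos (by simp) (by fun_prop) ?_ ⟨0, by simp⟩
  refine fun x hx => mul_nonneg (pow_nonneg ?_ _) ?_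
  · nlinarith [hx.1, hx.2]
  · refine cos_nonneg_of_neg_pi_div_two_le_of_le ?_ ?_ <;> nlinarith [hx.1, hx.2, pi_pos]

lemma cartwright_le (n : ℕ) : cartwright n ≤ 2 := by
  rw [← norm_of_nonneg (cartwright_pos n).le]
  refine (intervalIntegral.norm_integral_le_of_norm_le_const (C := 1) ?_).trans (by norm_num)
  intro x hx
  simp only [uIoc_of_le, neg_le_self_iff, zero_le_one, mem_Ioc] at hx
  rw [norm_eq_abs, abs_mul, abs_pow]
  refine mul_le_one₀ (pow_le_one₀ (abs_nonneg _) ?_) (abs_nonneg _) (abs_cos_le_one _)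
  rw [abs_le]
  constructor <;> nlinarith

/-- Clearing denominators by `q ^ n` makes the normalized Cartwright integrals integers as soon as
`π ^ 2 = p / q`: only `π ^ 2`, never `π` itself, enters their recursion. -/
lemma exists_int_cartwright {p : ℤ} {q : ℕ} (h : π ^ 2 * q = p) (n : ℕ) :
    (∃ z : ℤ, (q : ℝ) ^ n * (cartwright n * (π / 2) ^ (2 * n + 1) / n.factorial) = z) ∧
    ∃ z : ℤ, (q : ℝ) ^ (n + 1) *
      (cartwright (n + 1) * (π / 2) ^ (2 * (n + 1) + 1) / (n + 1).factorial) = z := by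
  induction n with
  | zero =>
    refine ⟨⟨2, ?_⟩, ⟨4 * q, ?_⟩⟩
    · simpa using cartwright_zero
    · have h1 : cartwright 1 * (π / 2) ^ 3 = 4 := by
        linear_combination (π / 2) * cartwright_one + 2 * cartwright_zero
      simp [h1, mul_comm]
  | succ n ih =>
    refine ⟨ih.2, ?_⟩
    obtain ⟨⟨z, hz⟩, ⟨y, hy⟩⟩ := ih
    refine ⟨(4 * n + 6) * q * y - p * q * z, ?_⟩
    push_cast
    rw [← hz, ← hy, ← h, show n + 1 + 1 = n + 2 by ring]
    have e := cartwright_add_two n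
    have f1 : ((n + 1).factorial : ℝ) = (n + 1) * n.factorial := by
      rw [Nat.factorial_succ]; push_cast; ring
    have f2 : ((n + 2).factorial : ℝ) = (n + 2) * ((n + 1) * n.factorial) := by
      rw [Nat.factorial_succ, Nat.factorial_succ]; push_cast; ring
    have hf : (n.factorial : ℝ) ≠ 0 := by positivity
    have e' : cartwright (n + 2) * (π / 2) ^ (2 * (n + 2) + 1)
        = (2 * (n + 2) * (2 * n + 3) * cartwright (n + 1) - 4 * (n + 2) * (n + 1) * cartwright n)
          * (π / 2) ^ (2 * n + 3) := by
      rw [← e]; ring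
    rw [e', f1, f2]
    have : (n : ℝ) + 1 ≠ 0 := by positivity
    have : (n : ℝ) + 2 ≠ 0 := by positivity
    field_simp
    ring

theorem irrational_pi_sq : Irrational (π ^ 2) := by
  rintro ⟨r, hr⟩
  have h : π ^ 2 * r.den = r.num := by
    rw [← hr]; exact_mod_cast Rat.mul_den_eq_num r
  have hq : (0 : ℝ) < r.den := by exact_mod_cast r.pos
  have hlim : Tendsto (fun n : ℕ => π * (((r.den : ℝ) * (π / 2) ^ 2) ^ n / n.factorial))
      atTop (𝓝 0) := by
    simpa using (FloorSemiring.tendsto_pow_div_factorial_atTop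
      ((r.den : ℝ) * (π / 2) ^ 2)).const_mul π
  obtain ⟨n, hn⟩ := (hlim.eventually_lt_const one_pos).exists
  obtain ⟨z, hz⟩ := (exists_int_cartwright h n).1
  have hpos : (0 : ℝ) < z := by
    rw [← hz]
    have := cartwright_pos n
    positivity
  have hlt : (z : ℝ) < 1 := by
    refine lt_of_le_of_lt ?_ hn
    rw [← hz]
    calc (r.den : ℝ) ^ n * (cartwright n * (π / 2) ^ (2 * n + 1) / n.factorial)
        ≤ (r.den : ℝ) ^ n * (2 * (π / 2) ^ (2 * n + 1) / n.factorial) := by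
          gcongr
          exact cartwright_le n
      _ = _ := by rw [mul_pow, ← pow_mul]; ring
  norm_cast at hpos hlt
  lia

/-- The shape parameter is `N π² / (16 - π²) - 1`; an integer value would make `π²` rational. -/
lemma shape_eq {N : ℕ} (hN : 1 ≤ N) : shape N = N * π ^ 2 / (16 - π ^ 2) - 1 := by
  have h0 : (N : ℝ) ≠ 0 := by positivity
  have h1 : (16 : ℝ) - π ^ 2 ≠ 0 := by nlinarith [pi_lt_four, pi_pos]
  have h2 : (1 : ℝ) - π ^ 2 / 16 ≠ 0 := by
    intro h; apply h1; linarith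
  simp only [shape, k₁, k₂]
  rw [sub_left_inj, div_eq_div_iff (by positivity) h1]
  ring

lemma shape_ne_int {N : ℕ} (hN : 1 ≤ N) (n : ℤ) : shape N ≠ n := by
  intro h
  rw [shape_eq hN] at h
  have h1 : (16 : ℝ) - π ^ 2 ≠ 0 := by nlinarith [pi_lt_four, pi_pos]
  have h3 : (N : ℝ) * π ^ 2 = (n + 1) * (16 - π ^ 2) := by
    rw [← h]; field_simp; ring
  have h4 : ((N : ℝ) + n + 1) * π ^ 2 = 16 * (n + 1) := by linear_combination h3
  have h5 : (N : ℝ) + n + 1 ≠ 0 := by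
    intro h5
    rw [h5] at h4
    have hN' : (1 : ℝ) ≤ N := by exact_mod_cast hN
    linarith
  apply irrational_pi_sq
  refine ⟨16 * (n + 1) / (N + n + 1), ?_⟩
  push_cast
  rw [div_eq_iff h5]
  linarith

lemma neg_one_lt_shape {N : ℕ} (hN : 1 ≤ N) : -1 < shape N := by
  rw [shape_eq hN]
  have h1 : (0 : ℝ) < 16 - π ^ 2 := by nlinarith [pi_lt_four, pi_pos]
  have : (0 : ℝ) < N * π ^ 2 / (16 - π ^ 2) := by positivity
  linarith

lemma scale_pos {N : ℕ} (hN : 1 ≤ N) : 0 < scale N := by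
  have h1 : (0 : ℝ) < 1 - π ^ 2 / 16 := by nlinarith [pi_lt_four, pi_pos]
  have h0 : (0 : ℝ) < N := by positivity
  unfold scale k₁ k₂
  positivity

/-! ### Even power series times a real power -/

/-- The coefficients of an entire power series: summable against every geometric sequence. -/
def EntireCoeff (c : ℕ → ℝ) : Prop := ∀ R : ℝ, 0 < R → Summable fun n => |c n| * R ^ n

/-- The series `∑ c n * w ^ (2 n + q)`: an even power series times a real power. -/
noncomputable def rpowSeries (c : ℕ → ℝ) (q w : ℝ) : ℝ := ∑' n : ℕ, c n * w ^ (2 * (n : ℝ) + q)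

lemma rpow_two_mul_add {w : ℝ} (hw : 0 < w) (n : ℕ) (q : ℝ) :
    w ^ (2 * (n : ℝ) + q) = (w ^ 2) ^ n * w ^ q := by
  rw [rpow_add hw, ← pow_mul, ← rpow_natCast]
  push_cast
  rfl

lemma EntireCoeff.mono {c d : ℕ → ℝ} (hc : EntireCoeff c) (h : ∀ n, |d n| ≤ |c n|) :
    EntireCoeff d := fun R hR =>
  (hc R hR).of_nonneg_of_le (fun _ => by positivity)
    fun n => mul_le_mul_of_nonneg_right (h n) (by positivity)

lemma EntireCoeff.summable {c : ℕ → ℝ} (hc : EntireCoeff c) (q : ℝ) {w : ℝ} (hw : 0 < w) :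
    Summable fun n : ℕ => c n * w ^ (2 * (n : ℝ) + q) := by
  refine Summable.of_norm_bounded ((hc (w ^ 2) (by positivity)).mul_right (w ^ q)) fun n => ?_
  rw [rpow_two_mul_add hw, norm_mul, norm_eq_abs, norm_eq_abs,
    abs_of_pos (show 0 < (w ^ 2) ^ n * w ^ q by positivity), mul_assoc]

lemma rpow_mul_rpowSeries (c : ℕ → ℝ) (p q : ℝ) {w : ℝ} (hw : 0 < w) :
    w ^ p * rpowSeries c q w = rpowSeries c (q + p) w := by
  rw [rpowSeries, rpowSeries, ← tsum_mul_left]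
  congr 1 with n
  rw [← add_assoc, rpow_add hw _ p]
  ring

lemma two_mul_add_le (n : ℕ) (q : ℝ) : |2 * (n : ℝ) + q| ≤ (2 + |q|) * 2 ^ n := by
  have h1 : (n : ℝ) ≤ 2 ^ n := by exact_mod_cast Nat.lt_two_pow_self.le
  have h2 : (1 : ℝ) ≤ 2 ^ n := one_le_pow₀ (by norm_num)
  calc |2 * (n : ℝ) + q| ≤ |2 * (n : ℝ)| + |q| := abs_add_le _ _
    _ = 2 * n + |q| * 1 := by rw [abs_of_nonneg (by positivity), mul_one]
    _ ≤ 2 * 2 ^ n + |q| * 2 ^ n := by gcongr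
    _ = _ := by ring

lemma EntireCoeff.mul_linear {c : ℕ → ℝ} (hc : EntireCoeff c) (q : ℝ) :
    EntireCoeff fun n => c n * (2 * n + q) := fun R hR => by
  refine ((hc (2 * R) (by positivity)).mul_right (2 + |q|)).of_nonneg_of_le
    (fun _ => by positivity) fun n => ?_
  rw [abs_mul, mul_pow]
  calc |c n| * |2 * (n : ℝ) + q| * R ^ n ≤ |c n| * ((2 + |q|) * 2 ^ n) * R ^ n := by
        gcongr; exact two_mul_add_le n q
    _ = _ := by ring

theorem hasDerivAt_rpowSeries {c : ℕ → ℝ} (hc : EntireCoeff c) (q : ℝ) {w : ℝ} (hw : 0 < w) :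
    HasDerivAt (rpowSeries c q) (rpowSeries (fun n => c n * (2 * n + q)) (q - 1) w) w := by
  have hsum := ((hc.mul_linear q) (4 * w ^ 2) (by positivity)).mul_right
    ((w / 2) ^ (q - 1) + (2 * w) ^ (q - 1))
  have hmem : w ∈ Ioo (w / 2) (2 * w) := ⟨by linarith, by linarith⟩
  have hd (n : ℕ) (t : ℝ) (ht : t ∈ Ioo (w / 2) (2 * w)) :
      HasDerivAt (fun t => c n * t ^ (2 * (n : ℝ) + q))
        (c n * (2 * n + q) * t ^ (2 * (n : ℝ) + (q - 1))) t := by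
    have ht0 : 0 < t := by have := ht.1; linarith
    refine ((hasDerivAt_rpow_const (p := 2 * (n : ℝ) + q)
      (Or.inl ht0.ne')).const_mul (c n)).congr_deriv ?_
    rw [mul_assoc, add_sub_assoc]
  have hb (n : ℕ) (t : ℝ) (ht : t ∈ Ioo (w / 2) (2 * w)) :
      ‖c n * (2 * n + q) * t ^ (2 * (n : ℝ) + (q - 1))‖
        ≤ |c n * (2 * n + q)| * (4 * w ^ 2) ^ n * ((w / 2) ^ (q - 1) + (2 * w) ^ (q - 1)) := by
    have ht0 : 0 < t := by have := ht.1; linarith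
    have hp : 0 < (t ^ 2) ^ n * t ^ (q - 1) := by positivity
    rw [rpow_two_mul_add ht0, norm_mul, norm_eq_abs, norm_eq_abs, abs_of_pos hp, mul_assoc]
    have h1 : (t ^ 2) ^ n ≤ (4 * w ^ 2) ^ n :=
      pow_le_pow_left₀ (by positivity) (by nlinarith [ht.1, ht.2]) n
    have h2 : t ^ (q - 1) ≤ (w / 2) ^ (q - 1) + (2 * w) ^ (q - 1) := by
      rcases le_total 0 (q - 1) with h | h
      · exact (rpow_le_rpow ht0.le ht.2.le h).trans (le_add_of_nonneg_left (by positivity))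
      · exact (rpow_le_rpow_of_nonpos (by positivity) ht.1.le h).trans
          (le_add_of_nonneg_right (by positivity))
    gcongr
  exact hasDerivAt_tsum_of_isPreconnected hsum isOpen_Ioo isPreconnected_Ioo hd hb hmem
    (hc.summable q hw) hmem

theorem tendsto_rpowSeries_zero {c : ℕ → ℝ} (hc : EntireCoeff c) {q : ℝ} (hq : 0 < q) :
    Tendsto (rpowSeries c q) (𝓝[>] 0) (𝓝 0) := by
  have h1 : Tendsto (fun w : ℝ => (∑' n, |c n|) * w ^ q) (𝓝[>] 0) (𝓝 0) := by
    have : ContinuousAt (fun w : ℝ => (∑' n, |c n|) * w ^ q) 0 :=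
      continuousAt_const.mul (continuousAt_rpow_const 0 q (Or.inr hq.le))
    have := this.tendsto
    rw [zero_rpow hq.ne', mul_zero] at this
    exact this.mono_left nhdsWithin_le_nhds
  refine squeeze_zero_norm' ?_ h1
  filter_upwards [Ioo_mem_nhdsGT (zero_lt_one' ℝ)] with w hw
  have hs : Summable fun n => |c n| := by simpa using hc 1 one_pos
  rw [← tsum_mul_right]
  refine tsum_of_norm_bounded (hs.mul_right _).hasSum fun n => ?_
  rw [norm_mul, norm_eq_abs, norm_eq_abs, abs_of_pos (rpow_pos_of_pos hw.1 _)]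
  exact mul_le_mul_of_nonneg_left (rpow_le_rpow_of_exponent_ge hw.1 hw.2.le
    (le_add_of_nonneg_left (by positivity))) (abs_nonneg _)

lemma entireCoeff_of_factorial {c : ℕ → ℝ} (K : ℝ) (h : ∀ n, |c n| ≤ K / n.factorial) :
    EntireCoeff c := fun R hR => by
  refine ((Real.summable_pow_div_factorial R).mul_left K).of_nonneg_of_le
    (fun _ => by positivity) fun n => ?_
  calc |c n| * R ^ n ≤ K / n.factorial * R ^ n := by gcongr; exact h n
    _ = _ := by ring

/-- The coefficients `(-1)ⁿ Γ(a - 1 - 2n)` of the series solution of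
`y'' + y = Γ(a+1) w^(-a-1)`. -/
noncomputable def gammaCoeff (a : ℝ) (n : ℕ) : ℝ := (-1) ^ n * Gamma (a - 1 - 2 * n)

lemma Gamma_ne_zero_of_ne_int {a : ℝ} (ha : ∀ n : ℤ, a ≠ n) : Gamma a ≠ 0 :=
  Gamma_ne_zero fun m => by simpa using ha (-m)

lemma ne_int_add {a : ℝ} (ha : ∀ n : ℤ, a ≠ n) (m : ℤ) : ∀ n : ℤ, a + m ≠ n := fun n h =>
  ha (n - m) (by push_cast; linarith)

lemma ne_int_arg {a : ℝ} (ha : ∀ n : ℤ, a ≠ n) (k : ℕ) : ∀ n : ℤ, a - 1 - 2 * k ≠ n := by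
  have := ne_int_add ha (-1 - 2 * k)
  intro n hn
  apply this n
  push_cast
  linarith

/-- Two steps of the functional equation of `Γ`. -/
lemma Gamma_add_two {x : ℝ} (hx : ∀ n : ℤ, x ≠ n) : Gamma (x + 2) = (x + 1) * x * Gamma x := by
  have h0 : x ≠ 0 := by simpa using hx 0
  have h1 : x + 1 ≠ 0 := by simpa using ne_int_add hx 1 0
  rw [show x + 2 = x + 1 + 1 by ring, Gamma_add_one h1, Gamma_add_one h0, mul_assoc]

lemma gammaCoeff_ne_zero {a : ℝ} (ha : ∀ n : ℤ, a ≠ n) (n : ℕ) : gammaCoeff a n ≠ 0 :=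
  mul_ne_zero (by simp) (Gamma_ne_zero_of_ne_int (ne_int_arg ha n))

lemma gammaCoeff_succ {a : ℝ} (ha : ∀ n : ℤ, a ≠ n) (n : ℕ) :
    gammaCoeff a n = -((a - 2 - 2 * n) * (a - 3 - 2 * n)) * gammaCoeff a (n + 1) := by
  have h := Gamma_add_two (ne_int_arg ha (n + 1))
  rw [show a - 1 - 2 * ((n + 1 : ℕ) : ℝ) + 2 = a - 1 - 2 * n by push_cast; ring] at h
  rw [gammaCoeff, gammaCoeff, h]
  push_cast
  ring

lemma entireCoeff_gammaCoeff {a : ℝ} (ha : ∀ n : ℤ, a ≠ n) : EntireCoeff (gammaCoeff a) := by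
  intro R hR
  refine summable_of_ratio_test_tendsto_lt_one (l := 0) one_pos
    (.of_forall fun n => mul_ne_zero (by simpa using gammaCoeff_ne_zero ha n) (by positivity)) ?_
  have hlim (k : ℝ) : Tendsto (fun n : ℕ => |a - k - 2 * (n : ℝ)|) atTop atTop := by
    refine tendsto_abs_atBot_atTop.comp (tendsto_atBot_add_const_left _ (a - k) ?_)
    simpa using (tendsto_natCast_atTop_atTop (R := ℝ)).const_mul_atTop (two_pos)
  have h := ((hlim 2).atTop_mul_atTop₀ (hlim 3)).const_div_atTop R
  refine h.congr fun n => ?_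
  have h1 := gammaCoeff_succ ha n
  have h0 := gammaCoeff_ne_zero ha n
  have h2 : gammaCoeff a (n + 1) ≠ 0 := gammaCoeff_ne_zero ha _
  rw [h1] at h0
  have h3 : (a - 2 - 2 * (n : ℝ)) ≠ 0 := by rintro h; simp [h] at h0
  have h4 : (a - 3 - 2 * (n : ℝ)) ≠ 0 := by rintro h; simp [h] at h0
  rw [h1]
  simp only [norm_mul, norm_eq_abs, abs_abs, abs_neg, abs_mul, abs_pow, abs_of_pos hR, pow_succ]
  have := abs_pos.2 h3
  have := abs_pos.2 h4
  have := abs_pos.2 h2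
  field_simp

/-! ### The Laplace transform of `y ^ a / (1 + y ^ 2)` -/

/-- A function on `(0, ∞)` with zero derivative and limit `l` at `0` is the constant `l`. -/
lemma eq_of_hasDerivAt_zero_of_tendsto {f : ℝ → ℝ} {l : ℝ}
    (hd : ∀ t, 0 < t → HasDerivAt f 0 t) (hl : Tendsto f (𝓝[>] 0) (𝓝 l)) {w : ℝ} (hw : 0 < w) :
    f w = l := by
  have hc : ∀ t ∈ Ioi (0 : ℝ), f t = f w := fun t ht =>
    isOpen_Ioi.is_const_of_deriv_eq_zero isPreconnected_Ioi
      (fun x hx => (hd x hx).differentiableAt.differentiableWithinAt)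
      (fun x hx => (hd x hx).deriv) ht hw
  refine tendsto_nhds_unique (tendsto_const_nhds.congr' ?_) hl
  filter_upwards [self_mem_nhdsWithin] with t ht using (hc t ht).symm

/-- The Laplace transform of `y ^ a / (1 + y ^ 2)` on the half-line. -/
noncomputable def laplaceKernel (a w : ℝ) : ℝ :=
  ∫ y in Ioi (0 : ℝ), y ^ a * exp (-(w * y)) / (1 + y ^ 2)

lemma integrableOn_rpow_mul_exp {a w : ℝ} (ha : -1 < a) (hw : 0 < w) :
    IntegrableOn (fun y : ℝ => y ^ a * exp (-(w * y))) (Ioi 0) := by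
  refine (integrableOn_rpow_mul_exp_neg_mul_rpow ha one_pos hw).congr_fun (fun y _ => ?_)
    measurableSet_Ioi
  simp

lemma integrableOn_laplaceKernel {a w : ℝ} (ha : -1 < a) (hw : 0 < w) :
    IntegrableOn (fun y : ℝ => y ^ a * exp (-(w * y)) / (1 + y ^ 2)) (Ioi 0) := by
  refine (integrableOn_rpow_mul_exp ha hw).mono' (Measurable.aestronglyMeasurable (by fun_prop))
    ((ae_restrict_mem measurableSet_Ioi).mono fun y (hy : 0 < y) => ?_)
  rw [norm_of_nonneg (by positivity)]
  exact div_le_self (by positivity) (by nlinarith)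

lemma laplaceKernel_add_two {a w : ℝ} (ha : -1 < a) (hw : 0 < w) :
    laplaceKernel (a + 2) w + laplaceKernel a w = Gamma (a + 1) * w ^ (-a - 1) := by
  rw [laplaceKernel, laplaceKernel, ← integral_add
    (integrableOn_laplaceKernel (by linarith) hw) (integrableOn_laplaceKernel ha hw)]
  have h := integral_rpow_mul_exp_neg_mul_Ioi (a := a + 1) (by linarith) hw
  rw [add_sub_cancel_right, one_div, inv_rpow hw.le, ← rpow_neg hw.le, neg_add', mul_comm] at h
  rw [← h]
  refine setIntegral_congr_fun measurableSet_Ioi fun y (hy : 0 < y) => ?_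
  have : (0 : ℝ) < 1 + y ^ 2 := by positivity
  simp only [rpow_add hy, rpow_two]
  field_simp
  ring

theorem hasDerivAt_laplaceKernel {a w : ℝ} (ha : -1 < a) (hw : 0 < w) :
    HasDerivAt (laplaceKernel a) (-laplaceKernel (a + 1) w) w := by
  have hd (y : ℝ) (hy : 0 < y) (t : ℝ) :
      HasDerivAt (fun t => y ^ a * exp (-(t * y)) / (1 + y ^ 2))
        (-(y ^ (a + 1) * exp (-(t * y)) / (1 + y ^ 2))) t := by
    refine ((((hasDerivAt_mul_const y).fun_neg.exp).const_mul (y ^ a)).div_const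
      (1 + y ^ 2)).congr_deriv ?_
    rw [rpow_add_one hy.ne']
    ring
  have h := (hasDerivAt_integral_of_dominated_loc_of_deriv_le
    (μ := volume.restrict (Ioi (0 : ℝ))) (s := Ioi (w / 2)) (x₀ := w)
    (F := fun t y => y ^ a * exp (-(t * y)) / (1 + y ^ 2))
    (F' := fun t y => -(y ^ (a + 1) * exp (-(t * y)) / (1 + y ^ 2)))
    (bound := fun y => y ^ (a + 1) * exp (-(w / 2 * y)) / (1 + y ^ 2))
    (Ioi_mem_nhds (by linarith)) (.of_forall fun t => Measurable.aestronglyMeasurable (by fun_prop))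
    (integrableOn_laplaceKernel ha hw) (Measurable.aestronglyMeasurable (by fun_prop))
    ((ae_restrict_mem measurableSet_Ioi).mono fun y (hy : 0 < y) t (ht : w / 2 < t) => ?_)
    (integrableOn_laplaceKernel (by linarith) (by positivity))
    ((ae_restrict_mem measurableSet_Ioi).mono fun y hy t _ => hd y hy t)).2
  · rwa [integral_neg] at h
  · rw [norm_neg, norm_of_nonneg (by positivity)]
    gcongr

/-- Writing `1 / (1 + y²)` as `∫ exp (-t (1 + y²)) dt` and integrating over `y` first leaves the
product `Γ(p) Γ(1 - p)` with `p = (a + 1) / 2`, to which the reflection formula applies. -/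
theorem integral_rpow_div_one_add_sq {a : ℝ} (ha : -1 < a) (ha' : a < 1) :
    IntegrableOn (fun y : ℝ => y ^ a / (1 + y ^ 2)) (Ioi 0) ∧
      ∫ y in Ioi (0 : ℝ), y ^ a / (1 + y ^ 2) = π / 2 * sec (a * π / 2) := by
  set f : ℝ → ℝ → ℝ := fun y t => y ^ a * exp (-(t * (1 + y ^ 2))) with hf
  have hy_int (t : ℝ) (ht : 0 < t) : IntegrableOn (fun y => f y t) (Ioi 0) := by
    have := (integrableOn_rpow_mul_exp_neg_mul_rpow ha two_pos ht).const_mul (exp (-t))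
    refine IntegrableOn.congr_fun this (fun y _ => ?_) measurableSet_Ioi
    simp only [hf, rpow_two]
    rw [show -(t * (1 + y ^ 2)) = -t + -t * y ^ 2 by ring, exp_add]
    ring
  have hy_eq (t : ℝ) (ht : 0 < t) : ∫ y in Ioi (0 : ℝ), f y t
      = t ^ ((1 - (a + 1) / 2) - 1) * exp (-(1 * t)) * (Gamma ((a + 1) / 2) / 2) := by
    have h := integral_rpow_mul_exp_neg_mul_rpow (p := 2) (q := a) (b := t) two_pos ha ht
    have h2 : ∫ y in Ioi (0 : ℝ), f y t
        = ∫ y in Ioi (0 : ℝ), exp (-t) * (y ^ a * exp (-t * y ^ (2 : ℝ))) := by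
      refine setIntegral_congr_fun measurableSet_Ioi fun y _ => ?_
      simp only [hf, rpow_two]
      rw [show -(t * (1 + y ^ 2)) = -t + -t * y ^ 2 by ring, exp_add]
      ring
    rw [h2, integral_const_mul, h, show (1 - (a + 1) / 2) - 1 = -(a + 1) / 2 by ring, one_mul]
    ring
  have hGam := integral_rpow_mul_exp_neg_mul_Ioi (a := 1 - (a + 1) / 2) (r := 1)
    (by linarith) one_pos
  have hint : Integrable (Function.uncurry f)
      ((volume.restrict (Ioi 0)).prod (volume.restrict (Ioi 0))) := by
    rw [integrable_prod_iff' (by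
      apply Measurable.aestronglyMeasurable
      simp only [Function.uncurry_def, hf]
      fun_prop)]
    refine ⟨(ae_restrict_mem measurableSet_Ioi).mono fun t ht => hy_int t ht, ?_⟩
    refine IntegrableOn.congr_fun ((integrableOn_rpow_mul_exp (a := (1 - (a + 1) / 2) - 1)
      (by linarith) one_pos).mul_const (Gamma ((a + 1) / 2) / 2)) (fun t ht => ?_)
      measurableSet_Ioi
    rw [← hy_eq t ht]
    refine setIntegral_congr_fun measurableSet_Ioi fun y (hy : 0 < y) => ?_
    simp only [hf, Function.uncurry]
    rw [norm_of_nonneg (by positivity)]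
  have hin (y : ℝ) : ∫ t in Ioi (0 : ℝ), f y t = y ^ a / (1 + y ^ 2) := by
    have hpos : 0 < 1 + y ^ 2 := by positivity
    have h := integral_exp_mul_Ioi (a := -(1 + y ^ 2)) (by linarith) 0
    simp only [hf]
    rw [integral_const_mul, div_eq_mul_one_div]
    congr 1
    simp only [mul_zero, exp_zero, neg_div_neg_eq] at h
    rw [← h]
    congr 1 with t
    congr 1
    ring
  have hswap := integral_integral_swap (f := f) hint
  simp only [hin] at hswap
  refine ⟨by simpa only [IntegrableOn, Function.uncurry, hin] using hint.integral_prod_left, ?_⟩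
  rw [hswap, setIntegral_congr_fun measurableSet_Ioi (fun t ht => hy_eq t ht),
    integral_mul_const, hGam, div_one, one_rpow, one_mul, mul_div_assoc',
    mul_comm (Gamma _) (Gamma _), Gamma_mul_Gamma_one_sub, sec,
    show π * ((a + 1) / 2) = a * π / 2 + π / 2 by ring, sin_add_pi_div_two]
  ring

lemma tendsto_laplaceKernel_zero {a : ℝ} (ha : -1 < a) (ha' : a < 1) :
    Tendsto (laplaceKernel a) (𝓝[>] 0) (𝓝 (π / 2 * sec (a * π / 2))) := by
  obtain ⟨hint, heq⟩ := integral_rpow_div_one_add_sq ha ha'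
  rw [← heq]
  refine tendsto_integral_filter_of_dominated_convergence _
    (.of_forall fun w => Measurable.aestronglyMeasurable (by fun_prop))
    ?_ hint ?_
  · filter_upwards [self_mem_nhdsWithin] with w (hw : 0 < w)
    refine (ae_restrict_mem measurableSet_Ioi).mono fun y (hy : 0 < y) => ?_
    rw [norm_of_nonneg (by positivity)]
    gcongr
    exact mul_le_of_le_one_right (by positivity) (exp_le_one_iff.2 (by nlinarith))
  · refine .of_forall fun y => ?_
    have : Continuous fun w : ℝ => y ^ a * exp (-(w * y)) / (1 + y ^ 2) := by fun_prop
    have := (this.tendsto 0).mono_left (nhdsWithin_le_nhds (s := Ioi 0))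
    simpa using this

/-- The value of `laplaceKernel`: a solution of `y'' + y = 0` plus a series that solves
`y'' + y = Γ(a+1) w^(-a-1)` term by term. -/
noncomputable def laplaceClosed (a w : ℝ) : ℝ :=
  π / 2 * (csc (a * π / 2) * sin w + sec (a * π / 2) * cos w) + rpowSeries (gammaCoeff a) (1 - a) w

lemma csc_add_one (a : ℝ) : csc ((a + 1) * π / 2) = sec (a * π / 2) := by
  rw [csc, sec, show (a + 1) * π / 2 = a * π / 2 + π / 2 by ring, sin_add_pi_div_two]

lemma sec_add_one (a : ℝ) : sec ((a + 1) * π / 2) = -csc (a * π / 2) := by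
  rw [csc, sec, show (a + 1) * π / 2 = a * π / 2 + π / 2 by ring, cos_add_pi_div_two, div_neg]

theorem hasDerivAt_laplaceClosed {a w : ℝ} (ha : ∀ n : ℤ, a ≠ n) (hw : 0 < w) :
    HasDerivAt (laplaceClosed a) (-laplaceClosed (a + 1) w) w := by
  have h := ((((hasDerivAt_sin w).const_mul (csc (a * π / 2))).fun_add
    ((hasDerivAt_cos w).const_mul (sec (a * π / 2)))).const_mul (π / 2)).fun_add
      (hasDerivAt_rpowSeries (entireCoeff_gammaCoeff ha) (1 - a) hw)
  refine h.congr_deriv ?_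
  have hs : rpowSeries (fun n => gammaCoeff a n * (2 * n + (1 - a))) (1 - a - 1) w
      = -rpowSeries (gammaCoeff (a + 1)) (1 - (a + 1)) w := by
    rw [rpowSeries, rpowSeries, ← tsum_neg]
    congr 1 with n
    have hne : a - 1 - 2 * (n : ℝ) ≠ 0 := by simpa using ne_int_arg ha n 0
    have hG := Gamma_add_one hne
    rw [gammaCoeff, gammaCoeff, show a + 1 - 1 - 2 * (n : ℝ) = a - 1 - 2 * n + 1 by ring, hG,
      show (1 : ℝ) - (a + 1) = 1 - a - 1 by ring]
    ring
  rw [laplaceClosed, csc_add_one, sec_add_one, hs]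
  ring

lemma laplaceClosed_add_two {a w : ℝ} (ha : ∀ n : ℤ, a ≠ n) (hw : 0 < w) :
    laplaceClosed (a + 2) w + laplaceClosed a w = Gamma (a + 1) * w ^ (-a - 1) := by
  have ha2 : ∀ n : ℤ, a + 2 ≠ n := by simpa using ne_int_add ha 2
  have hs : rpowSeries (gammaCoeff (a + 2)) (1 - (a + 2)) w
      = Gamma (a + 1) * w ^ (-a - 1) - rpowSeries (gammaCoeff a) (1 - a) w := by
    rw [rpowSeries, ((entireCoeff_gammaCoeff ha2).summable _ hw).tsum_eq_zero_add, rpowSeries,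
      sub_eq_add_neg (Gamma (a + 1) * w ^ (-a - 1)), ← tsum_neg]
    congr 1
    · rw [gammaCoeff]
      push_cast
      ring_nf
    · congr 1 with n
      rw [gammaCoeff, gammaCoeff]
      push_cast
      rw [show a + 2 - 1 - 2 * ((n : ℝ) + 1) = a - 1 - 2 * n by ring,
        show 2 * ((n : ℝ) + 1) + (1 - (a + 2)) = 2 * n + (1 - a) by ring]
      ring
  have h1 : csc ((a + 2) * π / 2) = -csc (a * π / 2) := by
    rw [show a + 2 = a + 1 + 1 by ring, csc_add_one, sec_add_one]
  have h2 : sec ((a + 2) * π / 2) = -sec (a * π / 2) := by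
    rw [show a + 2 = a + 1 + 1 by ring, sec_add_one, csc_add_one]
  rw [laplaceClosed, laplaceClosed, hs, h1, h2]
  ring

lemma tendsto_laplaceClosed_zero {a : ℝ} (ha : ∀ n : ℤ, a ≠ n) (ha' : a < 1) :
    Tendsto (laplaceClosed a) (𝓝[>] 0) (𝓝 (π / 2 * sec (a * π / 2))) := by
  have h1 : Continuous fun w => π / 2 * (csc (a * π / 2) * sin w + sec (a * π / 2) * cos w) := by
    fun_prop
  have h := ((h1.tendsto 0).mono_left (nhdsWithin_le_nhds (s := Ioi 0))).add
    (tendsto_rpowSeries_zero (entireCoeff_gammaCoeff ha) (q := 1 - a) (by linarith))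
  unfold laplaceClosed
  simpa using h

/-- On `(0, ∞)` the difference of the two sides satisfies `D'' = -D`, so `D ^ 2 + D' ^ 2` is constant;
for `-1 < a < 0` both `D` and `D'` vanish at `0`. -/
lemma laplaceKernel_eq_of_neg {a w : ℝ} (ha : -1 < a) (ha' : a < 0) (hw : 0 < w) :
    laplaceKernel a w = laplaceClosed a w := by
  have hni : ∀ n : ℤ, a ≠ n := by
    rintro n rfl
    have h1 : -1 < n := by exact_mod_cast ha
    have h2 : n < 0 := by exact_mod_cast ha'
    omega
  have hni1 : ∀ n : ℤ, a + 1 ≠ n := by simpa using ne_int_add hni 1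
  set D : ℝ → ℝ := fun t => laplaceKernel a t - laplaceClosed a t with hD
  set D' : ℝ → ℝ := fun t => laplaceKernel (a + 1) t - laplaceClosed (a + 1) t with hD'
  have hd (t : ℝ) (ht : 0 < t) : HasDerivAt D (-D' t) t :=
    ((hasDerivAt_laplaceKernel ha ht).fun_sub (hasDerivAt_laplaceClosed hni ht)).congr_deriv
      (by simp only [hD']; ring)
  have hd' (t : ℝ) (ht : 0 < t) : HasDerivAt D' (D t) t := by
    refine ((hasDerivAt_laplaceKernel (a := a + 1) (by linarith) ht).fun_sub
      (hasDerivAt_laplaceClosed hni1 ht)).congr_deriv ?_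
    have h1 := laplaceKernel_add_two ha ht
    have h2 := laplaceClosed_add_two hni ht
    simp only [hD, show a + 1 + 1 = a + 2 by ring]
    linarith
  have hlim : Tendsto (fun t => D t ^ 2 + D' t ^ 2) (𝓝[>] 0) (𝓝 0) := by
    have h0 := (tendsto_laplaceKernel_zero ha (by linarith)).sub
      (tendsto_laplaceClosed_zero hni (by linarith))
    have h1 := (tendsto_laplaceKernel_zero (a := a + 1) (by linarith) (by linarith)).sub
      (tendsto_laplaceClosed_zero hni1 (by linarith))
    simpa using (h0.pow 2).add (h1.pow 2)
  have hE := eq_of_hasDerivAt_zero_of_tendsto (f := fun t => D t ^ 2 + D' t ^ 2)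
    (fun t ht => (((hd t ht).fun_pow 2).fun_add ((hd' t ht).fun_pow 2)).congr_deriv
      (by push_cast; ring)) hlim hw
  have : D w ^ 2 = 0 := by nlinarith [sq_nonneg (D w), sq_nonneg (D' w)]
  exact sub_eq_zero.1 (pow_eq_zero_iff two_ne_zero |>.1 this)

theorem laplaceKernel_eq {a : ℝ} (ha : -1 < a) (hni : ∀ n : ℤ, a ≠ n) :
    ∀ w, 0 < w → laplaceKernel a w = laplaceClosed a w := by
  -- Differentiation in `w` raises `a` by one, so the claim climbs from `(-1, 0)` to all larger `a`.
  suffices ∀ (k : ℕ) (a : ℝ), -1 < a → a < k → (∀ n : ℤ, a ≠ n) →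
      ∀ w, 0 < w → laplaceKernel a w = laplaceClosed a w by
    obtain ⟨k, hk⟩ := exists_nat_gt a
    exact this k a ha hk hni
  intro k
  induction k with
  | zero => exact fun a h1 h2 _ w hw => laplaceKernel_eq_of_neg h1 (by simpa using h2) hw
  | succ k ih =>
    intro a h1 h2 hni w hw
    rcases lt_or_ge a 0 with h0 | h0
    · exact laplaceKernel_eq_of_neg h1 h0 hw
    have h0' : 0 < a := lt_of_le_of_ne h0 (by simpa using (hni 0).symm)
    have hni' : ∀ n : ℤ, a - 1 ≠ n := by simpa [sub_eq_add_neg] using ne_int_add hni (-1)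
    have hk := ih (a - 1) (by linarith) (by push_cast at h2; linarith) hni'
    have hd := hasDerivAt_laplaceKernel (a := a - 1) (by linarith) hw
    have hd2 : HasDerivAt (laplaceKernel (a - 1)) (-laplaceClosed (a - 1 + 1) w) w :=
      (hasDerivAt_laplaceClosed hni' hw).congr_of_eventuallyEq
        (by filter_upwards [Ioi_mem_nhds hw] with t ht using hk t ht)
    have := hd.unique hd2
    rw [sub_add_cancel] at this
    linarith

/-! ### The logarithmic integral -/

/-- The integral to which the capacity reduces, at `w = 1 / (b √ρ)`, after rescaling the channel
coefficient by `b` and splitting `log (b² ρ)` off. -/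
noncomputable def logIntegral (a w : ℝ) : ℝ :=
  ∫ x in Ioi (0 : ℝ), x ^ a * exp (-x) * log (w ^ 2 + x ^ 2)

lemma integrableOn_rpow_mul_exp_neg {a : ℝ} (ha : -1 < a) :
    IntegrableOn (fun x : ℝ => x ^ a * exp (-x)) (Ioi 0) := by
  simpa using integrableOn_rpow_mul_exp ha one_pos

/-- The integrable majorant of `x ^ a * exp (-x) * log (w ^ 2 + x ^ 2)` for `w ≤ 1`. -/
lemma integrableOn_rpow_mul_exp_neg_mul_log {a : ℝ} (ha : -1 < a) :
    IntegrableOn (fun x : ℝ => x ^ a * exp (-x) * (2 * |log x| + x ^ 2)) (Ioi 0) := by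
  set ε := (a + 1) / 2 with hε
  have hε0 : 0 < ε := by positivity [show 0 < a + 1 by linarith]
  have h1 := integrableOn_rpow_mul_exp_neg (a := a + ε) (by linarith)
  have h2 := integrableOn_rpow_mul_exp_neg (a := a - ε) (by linarith)
  have h3 := integrableOn_rpow_mul_exp_neg (a := a + 2) (by linarith)
  refine (((h1.add h2).const_mul (2 / ε)).add h3).mono'
    (Measurable.aestronglyMeasurable (by fun_prop))
    ((ae_restrict_mem measurableSet_Ioi).mono fun x (hx : 0 < x) => ?_)
  rw [norm_of_nonneg (by positivity)]
  have hlog : |log x| ≤ x ^ ε / ε + x ^ (-ε) / ε := by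
    have l1 := log_le_rpow_div hx.le hε0
    have l2 := log_le_rpow_div (inv_pos.2 hx).le hε0
    rw [log_inv, inv_rpow hx.le, ← rpow_neg hx.le] at l2
    have p1 : 0 < x ^ ε / ε := by positivity
    have p2 : 0 < x ^ (-ε) / ε := by positivity
    rw [abs_le]
    constructor <;> linarith
  calc x ^ a * exp (-x) * (2 * |log x| + x ^ 2)
      ≤ x ^ a * exp (-x) * (2 * (x ^ ε / ε + x ^ (-ε) / ε) + x ^ 2) := by gcongr
    _ = _ := by
      simp only [Pi.add_apply, sub_eq_add_neg a ε, rpow_add hx, rpow_two]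
      ring

lemma abs_log_add_sq_le {w x : ℝ} (hw : 0 < w) (hw1 : w ≤ 1) (hx : 0 < x) :
    |log (w ^ 2 + x ^ 2)| ≤ 2 * |log x| + x ^ 2 := by
  have h1 : log (w ^ 2 + x ^ 2) ≤ x ^ 2 :=
    (log_le_sub_one_of_pos (by positivity)).trans (by nlinarith)
  have h2 : 2 * log x ≤ log (w ^ 2 + x ^ 2) := by
    have := log_pow x 2
    push_cast at this
    rw [← this]
    exact log_le_log (by positivity) (by nlinarith)
  have h3 := neg_abs_le (log x)
  rw [abs_le]
  constructor <;> nlinarith [abs_nonneg (log x)]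

lemma integrableOn_logIntegral {a w : ℝ} (ha : -1 < a) (hw : 0 < w) :
    IntegrableOn (fun x : ℝ => x ^ a * exp (-x) * log (w ^ 2 + x ^ 2)) (Ioi 0) := by
  have h3 := integrableOn_rpow_mul_exp_neg (a := a + 2) (by linarith)
  refine (((integrableOn_rpow_mul_exp_neg ha).const_mul (2 * |log w|)).add
    (h3.const_mul ((w ^ 2)⁻¹))).mono'
    (Measurable.aestronglyMeasurable (by fun_prop))
    ((ae_restrict_mem measurableSet_Ioi).mono fun x (hx : 0 < x) => ?_)
  have he : log (w ^ 2 + x ^ 2) = 2 * log w + log (1 + x ^ 2 / w ^ 2) := by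
    have := log_pow w 2
    push_cast at this
    rw [← this, ← log_mul (by positivity) (by positivity)]
    congr 1
    field_simp
  have h0 : 0 ≤ log (1 + x ^ 2 / w ^ 2) := log_nonneg (le_add_of_nonneg_right (by positivity))
  have h1 : log (1 + x ^ 2 / w ^ 2) ≤ x ^ 2 / w ^ 2 :=
    (log_le_sub_one_of_pos (by positivity)).trans (by simp)
  have hb : |log (w ^ 2 + x ^ 2)| ≤ 2 * |log w| + x ^ 2 / w ^ 2 := by
    rw [he]
    refine (abs_add_le _ _).trans ?_
    rw [abs_mul, abs_two, abs_of_nonneg h0]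
    gcongr
  rw [norm_mul, norm_eq_abs (log _), norm_of_nonneg (by positivity)]
  calc x ^ a * exp (-x) * |log (w ^ 2 + x ^ 2)|
      ≤ x ^ a * exp (-x) * (2 * |log w| + x ^ 2 / w ^ 2) := by gcongr
    _ = _ := by
      simp only [Pi.add_apply, rpow_add hx, rpow_two]
      ring

lemma integral_kernel_eq (a : ℝ) {w : ℝ} (hw : 0 < w) :
    ∫ x in Ioi (0 : ℝ), x ^ a * exp (-x) * (2 * w / (w ^ 2 + x ^ 2))
      = 2 * (w ^ a * laplaceKernel a w) := by
  have h := integral_comp_mul_left_Ioi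
    (fun x : ℝ => x ^ a * exp (-x) * (2 * w / (w ^ 2 + x ^ 2))) 0 hw
  rw [mul_zero, smul_eq_mul, eq_inv_mul_iff_mul_eq₀ hw.ne'] at h
  rw [← h, laplaceKernel, ← integral_const_mul, ← integral_const_mul, ← integral_const_mul]
  refine setIntegral_congr_fun measurableSet_Ioi fun y (hy : 0 < y) => ?_
  have : (0 : ℝ) < 1 + y ^ 2 := by positivity
  have : (0 : ℝ) < w ^ 2 + (w * y) ^ 2 := by positivity
  simp only [mul_rpow hw.le hy.le]
  field_simp

theorem hasDerivAt_logIntegral {a w : ℝ} (ha : -1 < a) (hw : 0 < w) :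
    HasDerivAt (logIntegral a) (2 * (w ^ a * laplaceKernel a w)) w := by
  have hd (x : ℝ) (hx : 0 < x) (t : ℝ) :
      HasDerivAt (fun t => x ^ a * exp (-x) * log (t ^ 2 + x ^ 2))
        (x ^ a * exp (-x) * (2 * t / (t ^ 2 + x ^ 2))) t := by
    have h1 : HasDerivAt (fun t : ℝ => t ^ 2 + x ^ 2) (2 * t) t := by
      simpa using (hasDerivAt_pow 2 t).add_const (x ^ 2)
    exact (h1.log (by positivity)).const_mul _
  have h := (hasDerivAt_integral_of_dominated_loc_of_deriv_le
    (μ := volume.restrict (Ioi (0 : ℝ))) (s := Ioi (w / 2)) (x₀ := w)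
    (F := fun t x => x ^ a * exp (-x) * log (t ^ 2 + x ^ 2))
    (F' := fun t x => x ^ a * exp (-x) * (2 * t / (t ^ 2 + x ^ 2)))
    (bound := fun x => x ^ a * exp (-x) * (4 / w))
    (Ioi_mem_nhds (by linarith)) (.of_forall fun t => Measurable.aestronglyMeasurable (by fun_prop))
    (integrableOn_logIntegral ha hw) (Measurable.aestronglyMeasurable (by fun_prop))
    ((ae_restrict_mem measurableSet_Ioi).mono fun x (hx : 0 < x) t (ht : w / 2 < t) => ?_)
    ((integrableOn_rpow_mul_exp_neg ha).mul_const (4 / w))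
    ((ae_restrict_mem measurableSet_Ioi).mono fun x hx t _ => hd x hx t)).2
  · rwa [integral_kernel_eq a hw] at h
  · have ht0 : 0 < t := by linarith
    rw [norm_of_nonneg (by positivity)]
    refine mul_le_mul_of_nonneg_left ?_ (by positivity)
    rw [div_le_div_iff₀ (by positivity) hw]
    nlinarith [sq_nonneg x]

theorem integral_rpow_mul_exp_neg_mul_log {a : ℝ} (ha : -1 < a) :
    ∫ x in Ioi (0 : ℝ), x ^ a * exp (-x) * log x = Gamma (a + 1) * digamma (1 + a) := by
  have hs : 0 < ((1 + a : ℝ) : ℂ).re := by rw [Complex.ofReal_re]; linarith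
  have hG : HasDerivAt Complex.Gamma
      (((∫ x in Ioi (0 : ℝ), x ^ a * exp (-x) * log x : ℝ)) : ℂ) ((1 + a : ℝ) : ℂ) := by
    have h := Complex.hasDerivAt_GammaIntegral hs
    have he : Complex.GammaIntegral =ᶠ[𝓝 ((1 + a : ℝ) : ℂ)] Complex.Gamma := by
      filter_upwards [(isOpen_lt continuous_const Complex.continuous_re).mem_nhds hs] with z hz
        using (Complex.Gamma_eq_integral hz).symm
    refine (h.congr_of_eventuallyEq he.symm).congr_deriv ?_
    rw [← integral_complex_ofReal]
    refine setIntegral_congr_fun measurableSet_Ioi fun x (hx : 0 < x) => ?_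
    rw [show ((1 + a : ℝ) : ℂ) - 1 = (a : ℂ) by push_cast; ring, ← Complex.ofReal_cpow hx.le]
    push_cast
    ring
  have hne : Gamma (1 + a) ≠ 0 := (Gamma_pos_of_pos (by linarith)).ne'
  rw [digamma, Complex.digamma_def, logDeriv_apply, hG.deriv, Complex.Gamma_ofReal,
    ← Complex.ofReal_div, Complex.ofReal_re, add_comm a 1]
  field_simp

lemma tendsto_logIntegral_zero {a : ℝ} (ha : -1 < a) :
    Tendsto (logIntegral a) (𝓝[>] 0) (𝓝 (2 * (Gamma (a + 1) * digamma (1 + a)))) := by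
  rw [← integral_rpow_mul_exp_neg_mul_log ha, ← integral_const_mul]
  refine tendsto_integral_filter_of_dominated_convergence _
    (.of_forall fun w => Measurable.aestronglyMeasurable (by fun_prop)) ?_
    (integrableOn_rpow_mul_exp_neg_mul_log ha) ?_
  · filter_upwards [Ioo_mem_nhdsGT (zero_lt_one' ℝ)] with w hw
    refine (ae_restrict_mem measurableSet_Ioi).mono fun x (hx : 0 < x) => ?_
    rw [norm_mul, norm_eq_abs (log _), norm_of_nonneg (by positivity)]
    exact mul_le_mul_of_nonneg_left (abs_log_add_sq_le hw.1 hw.2.le hx) (by positivity)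
  · refine (ae_restrict_mem measurableSet_Ioi).mono fun x (hx : 0 < x) => ?_
    have hc : ContinuousAt (fun w : ℝ => x ^ a * exp (-x) * log (w ^ 2 + x ^ 2)) 0 :=
      continuousAt_const.mul (ContinuousAt.log (by fun_prop) (by positivity))
    have := hc.tendsto.mono_left (nhdsWithin_le_nhds (s := Ioi 0))
    convert this using 2
    rw [zero_pow two_ne_zero, zero_add, log_pow]
    push_cast
    ring

/-- Coefficients of the term-by-term primitive of `w ^ a * sin w`. -/
noncomputable def sinCoeff (a : ℝ) (n : ℕ) : ℝ :=
  (-1) ^ n / ((2 * n + 1).factorial * (2 * n + (a + 2)))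

/-- Coefficients of the term-by-term primitive of `w ^ a * cos w`. -/
noncomputable def cosCoeff (a : ℝ) (n : ℕ) : ℝ :=
  (-1) ^ n / ((2 * n).factorial * (2 * n + (a + 1)))

lemma entireCoeff_sinCoeff {a : ℝ} (ha : -1 < a) : EntireCoeff (sinCoeff a) := by
  refine entireCoeff_of_factorial ((a + 2)⁻¹) fun n => ?_
  have h2 : 0 < a + 2 := by linarith
  have h1 : (n.factorial : ℝ) ≤ (2 * n + 1).factorial := by
    exact_mod_cast Nat.factorial_le (by omega)
  rw [sinCoeff, abs_div, abs_pow, abs_neg, abs_one, one_pow, abs_of_pos (by positivity),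
    ← one_div, div_div, mul_comm (a + 2)]
  exact one_div_le_one_div_of_le (by positivity)
    (mul_le_mul h1 (by linarith [n.cast_nonneg (α := ℝ)]) (by positivity) (by positivity))

lemma entireCoeff_cosCoeff {a : ℝ} (ha : -1 < a) : EntireCoeff (cosCoeff a) := by
  refine entireCoeff_of_factorial ((a + 1)⁻¹) fun n => ?_
  have h2 : 0 < a + 1 := by linarith
  have h1 : (n.factorial : ℝ) ≤ (2 * n).factorial := by
    exact_mod_cast Nat.factorial_le (by omega)
  rw [cosCoeff, abs_div, abs_pow, abs_neg, abs_one, one_pow, abs_of_pos (by positivity),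
    ← one_div, div_div, mul_comm (a + 1)]
  exact one_div_le_one_div_of_le (by positivity)
    (mul_le_mul h1 (by linarith [n.cast_nonneg (α := ℝ)]) (by positivity) (by positivity))

lemma entireCoeff_gammaCoeff_div {a : ℝ} (ha : ∀ n : ℤ, a ≠ n) :
    EntireCoeff fun n => gammaCoeff a n / (n + 1) := by
  refine (entireCoeff_gammaCoeff ha).mono fun n => ?_
  rw [abs_div, abs_of_pos (show (0 : ℝ) < n + 1 by positivity)]
  exact div_le_self (abs_nonneg _) (by linarith [n.cast_nonneg (α := ℝ)])

lemma hasDerivAt_sinSeries {a w : ℝ} (ha : -1 < a) (hw : 0 < w) :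
    HasDerivAt (rpowSeries (sinCoeff a) (a + 2)) (w ^ a * sin w) w := by
  refine (hasDerivAt_rpowSeries (entireCoeff_sinCoeff ha) (a + 2) hw).congr_deriv ?_
  rw [← (hasSum_sin w).tsum_eq, ← tsum_mul_left, rpowSeries]
  congr 1 with n
  have : (0 : ℝ) < 2 * n + (a + 2) := by linarith [n.cast_nonneg (α := ℝ)]
  rw [sinCoeff, show 2 * (n : ℝ) + (a + 2 - 1) = a + (2 * n + 1 : ℕ) by push_cast; ring,
    rpow_add hw, rpow_natCast]
  field_simp

lemma hasDerivAt_cosSeries {a w : ℝ} (ha : -1 < a) (hw : 0 < w) :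
    HasDerivAt (rpowSeries (cosCoeff a) (a + 1)) (w ^ a * cos w) w := by
  refine (hasDerivAt_rpowSeries (entireCoeff_cosCoeff ha) (a + 1) hw).congr_deriv ?_
  rw [← (hasSum_cos w).tsum_eq, ← tsum_mul_left, rpowSeries]
  congr 1 with n
  have : (0 : ℝ) < 2 * n + (a + 1) := by linarith [n.cast_nonneg (α := ℝ)]
  rw [cosCoeff, show 2 * (n : ℝ) + (a + 1 - 1) = a + (2 * n : ℕ) by push_cast; ring,
    rpow_add hw, rpow_natCast]
  field_simp

lemma hasDerivAt_gammaSeries {a w : ℝ} (ha : ∀ n : ℤ, a ≠ n) (hw : 0 < w) :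
    HasDerivAt (rpowSeries (fun n => gammaCoeff a n / (n + 1)) 2)
      (2 * (w ^ a * rpowSeries (gammaCoeff a) (1 - a) w)) w := by
  refine (hasDerivAt_rpowSeries (entireCoeff_gammaCoeff_div ha) 2 hw).congr_deriv ?_
  rw [rpow_mul_rpowSeries _ _ _ hw, rpowSeries, rpowSeries, ← tsum_mul_left]
  congr 1 with n
  have : (n : ℝ) + 1 ≠ 0 := by positivity
  rw [show 2 * (n : ℝ) + (2 - 1) = 2 * n + (1 - a + a) by ring]
  field_simp

theorem logIntegral_eq {a w : ℝ} (ha : -1 < a) (hni : ∀ n : ℤ, a ≠ n) (hw : 0 < w) :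
    logIntegral a w = 2 * (Gamma (a + 1) * digamma (1 + a))
      + (π * csc (a * π / 2) * rpowSeries (sinCoeff a) (a + 2) w
      + π * sec (a * π / 2) * rpowSeries (cosCoeff a) (a + 1) w
      + rpowSeries (fun n => gammaCoeff a n / (n + 1)) 2 w) := by
  rw [← sub_eq_iff_eq_add]
  refine eq_of_hasDerivAt_zero_of_tendsto
    (f := fun w => logIntegral a w - (π * csc (a * π / 2) * rpowSeries (sinCoeff a) (a + 2) w
      + π * sec (a * π / 2) * rpowSeries (cosCoeff a) (a + 1) w
      + rpowSeries (fun n => gammaCoeff a n / (n + 1)) 2 w)) (fun t ht => ?_) ?_ hw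
  · refine ((hasDerivAt_logIntegral ha ht).fun_sub
      ((((hasDerivAt_sinSeries ha ht).const_mul (π * csc (a * π / 2))).fun_add
      ((hasDerivAt_cosSeries ha ht).const_mul (π * sec (a * π / 2)))).fun_add
      (hasDerivAt_gammaSeries hni ht))).congr_deriv ?_
    rw [laplaceKernel_eq ha hni t ht, laplaceClosed]
    ring
  · have h1 := (tendsto_rpowSeries_zero (entireCoeff_sinCoeff ha)
      (q := a + 2) (by linarith)).const_mul (π * csc (a * π / 2))
    have h2 := (tendsto_rpowSeries_zero (entireCoeff_cosCoeff ha)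
      (q := a + 1) (by linarith)).const_mul (π * sec (a * π / 2))
    have h3 := tendsto_rpowSeries_zero (entireCoeff_gammaCoeff_div hni) two_pos
    simpa using (tendsto_logIntegral_zero ha).sub ((h1.add h2).add h3)

/-! ### Hypergeometric series as power series -/

lemma poch_zero (x : ℝ) : poch x 0 = 1 := by simp [poch]

lemma poch_succ (x : ℝ) (n : ℕ) : poch x (n + 1) = poch x n * (x + n) :=
  ascPochhammer_succ_eval n x

lemma poch_pos {x : ℝ} (hx : 0 < x) (n : ℕ) : 0 < poch x n := by
  induction n with
  | zero => simp [poch_zero]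
  | succ n ih => rw [poch_succ]; positivity

lemma poch_mul_add (x : ℝ) (n : ℕ) : poch x n * (x + n) = x * poch (x + 1) n := by
  induction n with
  | zero => simp [poch_zero]
  | succ n ih =>
    rw [poch_succ, ih, poch_succ]
    push_cast
    ring

lemma poch_one (n : ℕ) : poch 1 n = n.factorial := by
  induction n with
  | zero => simp [poch_zero]
  | succ n ih => rw [poch_succ, ih, Nat.factorial_succ]; push_cast; ring

lemma poch_two (n : ℕ) : poch 2 n = (n + 1).factorial := by
  induction n with
  | zero => simp [poch_zero]
  | succ n ih => rw [poch_succ, ih, Nat.factorial_succ (n + 1)]; push_cast; ring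

lemma poch_half (n : ℕ) : poch (1 / 2) n * n.factorial * 4 ^ n = (2 * n).factorial := by
  induction n with
  | zero => simp [poch_zero]
  | succ n ih =>
    rw [show 2 * (n + 1) = 2 * n + 1 + 1 by ring, Nat.factorial_succ (2 * n + 1),
      Nat.factorial_succ (2 * n), Nat.factorial_succ n, poch_succ]
    push_cast
    rw [← ih]
    ring

lemma poch_three_halves (n : ℕ) : poch (3 / 2) n * n.factorial * 4 ^ n = (2 * n + 1).factorial := by
  induction n with
  | zero => simp [poch_zero]
  | succ n ih =>
    rw [show 2 * (n + 1) + 1 = 2 * n + 1 + 1 + 1 by ring, Nat.factorial_succ (2 * n + 1 + 1),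
      Nat.factorial_succ (2 * n + 1), Nat.factorial_succ n, poch_succ]
    push_cast
    rw [← ih]
    ring

/-- Each step in `n` lowers the argument of `Γ` by two, which the two Pochhammer factors undo. -/
lemma poch_mul_poch_mul_gammaCoeff {a : ℝ} (ha : ∀ n : ℤ, a ≠ n) (n : ℕ) :
    poch (1 - a / 2) n * poch ((3 - a) / 2) n * (-4) ^ n * gammaCoeff a n = Gamma (a - 1) := by
  induction n with
  | zero => simp [poch_zero, gammaCoeff]
  | succ n ih =>
    rw [← ih, gammaCoeff_succ ha n, poch_succ, poch_succ]
    ring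

/-- The argument `-w² / 4` of the three hypergeometric series, raised to the power `n`. -/
lemma neg_sq_div_four_pow (w : ℝ) (n : ℕ) :
    (-(w ^ 2 / 4)) ^ n = (-1) ^ n * (w ^ 2) ^ n / 4 ^ n := by
  rw [← neg_one_mul, mul_pow, div_pow, mul_div_assoc]

lemma pFq_sin {a w : ℝ} (ha : -1 < a) (hw : 0 < w) :
    pFq [1 + a / 2] [3 / 2, 2 + a / 2] (-(w ^ 2 / 4)) * w ^ (a + 2) / (a + 2)
      = rpowSeries (sinCoeff a) (a + 2) w := by
  rw [pFq, rpowSeries, mul_div_assoc, ← tsum_mul_right]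
  congr 1 with n
  have h1 := poch_mul_add (1 + a / 2) n
  have h2 := poch_pos (show 0 < 1 + a / 2 + 1 by linarith) n
  have h3 := poch_pos (show (0 : ℝ) < 3 / 2 by norm_num) n
  have hn := n.cast_nonneg (α := ℝ)
  have h4 : 0 < 2 * (n : ℝ) + (a + 2) := by linarith
  have h5 : 0 < a + 2 := by linarith
  have h6 : poch (1 + a / 2) n = (a + 2) * poch (1 + a / 2 + 1) n / (2 * n + (a + 2)) := by
    rw [eq_div_iff h4.ne']
    linear_combination 2 * h1
  rw [neg_sq_div_four_pow, rpow_two_mul_add hw, sinCoeff, ← poch_three_halves]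
  simp only [List.map_cons, List.map_nil, List.prod_cons, List.prod_nil, mul_one]
  rw [show 2 + a / 2 = 1 + a / 2 + 1 by ring, h6]
  generalize poch (1 + a / 2 + 1) n = p at h2 ⊢
  field_simp

lemma pFq_cos {a w : ℝ} (ha : -1 < a) (hw : 0 < w) :
    pFq [(a + 1) / 2] [1 / 2, (a + 3) / 2] (-(w ^ 2 / 4)) * w ^ (a + 1) / (a + 1)
      = rpowSeries (cosCoeff a) (a + 1) w := by
  rw [pFq, rpowSeries, mul_div_assoc, ← tsum_mul_right]
  congr 1 with n
  have h1 := poch_mul_add ((a + 1) / 2) n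
  have h2 := poch_pos (show 0 < (a + 1) / 2 + 1 by linarith) n
  have h3 := poch_pos (show (0 : ℝ) < 1 / 2 by norm_num) n
  have hn := n.cast_nonneg (α := ℝ)
  have h4 : 0 < 2 * (n : ℝ) + (a + 1) := by linarith
  have h5 : 0 < a + 1 := by linarith
  have h6 : poch ((a + 1) / 2) n = (a + 1) * poch ((a + 1) / 2 + 1) n / (2 * n + (a + 1)) := by
    rw [eq_div_iff h4.ne']
    linear_combination 2 * h1
  rw [neg_sq_div_four_pow, rpow_two_mul_add hw, cosCoeff, ← poch_half]
  simp only [List.map_cons, List.map_nil, List.prod_cons, List.prod_nil, mul_one]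
  rw [show (a + 3) / 2 = (a + 1) / 2 + 1 by ring, h6]
  generalize poch ((a + 1) / 2 + 1) n = p at h2 ⊢
  field_simp

lemma pFq_gamma {a w : ℝ} (ha : ∀ n : ℤ, a ≠ n) (hw : 0 < w) :
    Gamma (a - 1) * pFq [1, 1] [2, 1 - a / 2, (3 - a) / 2] (-(w ^ 2 / 4)) * w ^ 2
      = rpowSeries (fun n => gammaCoeff a n / (n + 1)) 2 w := by
  rw [pFq, rpowSeries, mul_right_comm, ← tsum_mul_left]
  congr 1 with n
  have h1 := poch_mul_poch_mul_gammaCoeff ha n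
  have hG : Gamma (a - 1) ≠ 0 := Gamma_ne_zero_of_ne_int (by simpa using ne_int_arg ha 0)
  have h2 : poch (1 - a / 2) n ≠ 0 := by rintro h; simp [h, hG.symm] at h1
  have h3 : poch ((3 - a) / 2) n ≠ 0 := by rintro h; simp [h, hG.symm] at h1
  have h4 : ((-1 : ℝ) ^ n) * (-1) ^ n = 1 := by rw [← mul_pow]; simp
  have h5 : (-4 : ℝ) ^ n = (-1) ^ n * 4 ^ n := by rw [← mul_pow]; norm_num
  rw [neg_sq_div_four_pow, rpow_two_mul_add hw, ← h1, h5]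
  simp only [List.map_cons, List.map_nil, List.prod_cons, List.prod_nil, mul_one]
  rw [poch_one, poch_two, Nat.factorial_succ, rpow_two]
  push_cast
  generalize poch (1 - a / 2) n = p at h2 ⊢
  generalize poch ((3 - a) / 2) n = p' at h3 ⊢
  field_simp
  linear_combination gammaCoeff a n * h4

/-! ### The expectation against the channel density -/

/-- The substitution `x = b y` in the expected rate; then
`1 + ρ x² = b² ρ (w² + y²)` with `w = 1 / (b √ρ)`. -/
lemma channelPDF_mul_logb {a b ρ y : ℝ} (hb : 0 < b) (hρ : 0 < ρ) (hy : 0 < y) :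
    channelPDF a b (b * y) * logb 2 (1 + ρ * (b * y) ^ 2)
      = (b * Gamma (a + 1) * log 2)⁻¹ * (y ^ a * exp (-y) * log (b ^ 2 * ρ)
        + y ^ a * exp (-y) * log (((b * √ρ)⁻¹) ^ 2 + y ^ 2)) := by
  have hw : ((b * √ρ)⁻¹) ^ 2 = (b ^ 2 * ρ)⁻¹ := by
    rw [inv_pow, mul_pow, sq_sqrt hρ.le]
  have hl : log (1 + ρ * (b * y) ^ 2) = log (b ^ 2 * ρ) + log ((b ^ 2 * ρ)⁻¹ + y ^ 2) := by
    rw [← log_mul (by positivity) (by positivity)]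
    congr 1
    field_simp
  rw [channelPDF, if_pos (by positivity), hw, logb, hl, mul_rpow hb.le hy.le, rpow_add_one hb.ne',
    show -(b * y) / b = -y by field_simp]
  have : b ^ a ≠ 0 := (rpow_pos_of_pos hb a).ne'
  field_simp

lemma integral_channelPDF_mul_logb {a b ρ : ℝ} (ha : -1 < a) (hb : 0 < b) (hρ : 0 < ρ) :
    Integrable (fun x => channelPDF a b x * logb 2 (1 + ρ * x ^ 2)) ∧
      ∫ x, channelPDF a b x * logb 2 (1 + ρ * x ^ 2)
        = (Gamma (a + 1) * log 2)⁻¹ * (Gamma (a + 1) * log (b ^ 2 * ρ)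
          + logIntegral a ((b * √ρ)⁻¹)) := by
  set φ : ℝ → ℝ := fun x => channelPDF a b x * logb 2 (1 + ρ * x ^ 2) with hφ
  have hw : 0 < (b * √ρ)⁻¹ := by positivity
  have i1 := (integrableOn_rpow_mul_exp_neg ha).mul_const (log (b ^ 2 * ρ))
  have i2 := integrableOn_logIntegral ha hw
  have hsupp : Function.support φ ⊆ Ioi 0 := by
    intro x hx
    by_contra h
    have h' : ¬ 0 < x := h
    simp [hφ, channelPDF, h'] at hx
  have hcongr : EqOn (fun y => (b * Gamma (a + 1) * log 2)⁻¹ * (y ^ a * exp (-y) * log (b ^ 2 * ρ)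
        + y ^ a * exp (-y) * log (((b * √ρ)⁻¹) ^ 2 + y ^ 2))) (fun y => φ (b * y)) (Ioi 0) :=
    fun y hy => (channelPDF_mul_logb hb hρ hy).symm
  constructor
  · rw [← integrableOn_iff_integrable_of_support_subset hsupp]
    have := (integrableOn_Ioi_comp_mul_left_iff φ 0 hb).1
      (IntegrableOn.congr_fun ((i1.add i2).const_mul _) hcongr measurableSet_Ioi)
    rwa [mul_zero] at this
  · have h := integral_comp_mul_left_Ioi φ 0 hb
    rw [mul_zero, smul_eq_mul, eq_inv_mul_iff_mul_eq₀ hb.ne'] at h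
    have hG : ∫ y in Ioi (0 : ℝ), y ^ a * exp (-y) = Gamma (a + 1) := by
      rw [Gamma_eq_integral (by linarith)]
      refine setIntegral_congr_fun measurableSet_Ioi fun y _ => ?_
      simp only [add_sub_cancel_right]
      ring
    rw [← setIntegral_eq_integral_of_forall_compl_eq_zero
      (fun x hx => Function.notMem_support.1 fun h' => hx (hsupp h')), ← h,
      ← setIntegral_congr_fun measurableSet_Ioi hcongr, integral_const_mul, integral_add i1 i2,
      integral_mul_const, hG, ← logIntegral]
    have : 0 < Gamma (a + 1) := Gamma_pos_of_pos (by linarith)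
    have : 0 < log 2 := log_pos one_lt_two
    field_simp

lemma measurable_channelPDF (a b : ℝ) : Measurable (channelPDF a b) := by
  unfold channelPDF
  exact Measurable.ite measurableSet_Ioi (by fun_prop) (by fun_prop)

lemma channelPDF_nonneg {a b : ℝ} (ha : -1 < a) (hb : 0 < b) (x : ℝ) : 0 ≤ channelPDF a b x := by
  have : 0 < Gamma (a + 1) := Gamma_pos_of_pos (by linarith)
  unfold channelPDF
  split_ifs <;> positivity

lemma integrable_rate_and_capacity {Ω : Type*} [MeasurableSpace Ω] {P : Measure Ω} {A : Ω → ℝ}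
    {a b ρ : ℝ} (ha : -1 < a) (hb : 0 < b) (hρ : 0 < ρ) (hA : HasChannelPDF P A a b) :
    Integrable (rate ρ A) P ∧ ergodicCapacity P ρ A = (Gamma (a + 1) * log 2)⁻¹ *
      (Gamma (a + 1) * log (b ^ 2 * ρ) + logIntegral a ((b * √ρ)⁻¹)) := by
  obtain ⟨hmeas, hmap⟩ := hA
  obtain ⟨hint, heq⟩ := integral_channelPDF_mul_logb ha hb hρ
  have hg : Measurable fun x : ℝ => logb 2 (1 + ρ * x ^ 2) := by unfold logb; fun_prop
  have hpdf := (measurable_channelPDF a b).ennreal_ofReal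
  constructor
  · have h := integrable_map_measure (μ := P) (f := A) hg.aestronglyMeasurable hmeas
    rw [hmap, integrable_withDensity_iff_integrable_smul' hpdf (.of_forall fun _ => by simp)] at h
    refine h.1 (hint.congr (.of_forall fun x => ?_))
    simp [ENNReal.toReal_ofReal (channelPDF_nonneg ha hb x)]
  · have h := integral_map (μ := P) (φ := A) hmeas hg.aestronglyMeasurable
    rw [hmap, integral_withDensity_eq_integral_toReal_smul hpdf (.of_forall fun _ => by simp)] at h
    rw [ergodicCapacity, ← heq]
    refine h.symm.trans (integral_congr_ae (.of_forall fun x => ?_))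
    simp [ENNReal.toReal_ofReal (channelPDF_nonneg ha hb x)]

theorem capacityFormula_eq {a b ρ : ℝ} (ha : -1 < a) (hni : ∀ n : ℤ, a ≠ n) (hb : 0 < b)
    (hρ : 0 < ρ) : capacityFormula a b ρ = (Gamma (a + 1) * log 2)⁻¹ *
      (Gamma (a + 1) * log (b ^ 2 * ρ) + logIntegral a ((b * √ρ)⁻¹)) := by
  set w := (b * √ρ)⁻¹ with hw_def
  have hw : 0 < w := by positivity
  have hw2 : w ^ 2 = (b ^ 2 * ρ)⁻¹ := by rw [hw_def, inv_pow, mul_pow, sq_sqrt hρ.le]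
  have hwr (p : ℝ) : w ^ p = (b ^ p * ρ ^ (p / 2))⁻¹ := by
    rw [hw_def, inv_rpow (by positivity), mul_rpow hb.le (by positivity), sqrt_eq_rpow,
      ← rpow_mul hρ.le]
    ring_nf
  have harg : -(1 / (4 * b ^ 2 * ρ)) = -(w ^ 2 / 4) := by rw [hw2]; field_simp
  have h0 : a ≠ 0 := by simpa using hni 0
  have h1 : a - 1 ≠ 0 := sub_ne_zero.2 (by simpa using hni 1)
  have hp : poch (a - 1) 2 = a ^ 2 - a := by
    rw [poch_succ, poch_succ, poch_zero]; push_cast; ring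
  have hp0 : a ^ 2 - a ≠ 0 := by rw [show a ^ 2 - a = a * (a - 1) by ring]; exact mul_ne_zero h0 h1
  have hG := Gamma_add_two (x := a - 1) (by simpa using ne_int_arg hni 0)
  rw [show a - 1 + 2 = a + 1 by ring, sub_add_cancel] at hG
  have hGpos : 0 < Gamma (a + 1) := Gamma_pos_of_pos (by linarith)
  have hG' : Gamma (a - 1) = Gamma (a + 1) / (a ^ 2 - a) := by
    rw [eq_div_iff hp0, hG]; ring
  have hlog : 0 < log 2 := log_pos one_lt_two
  have ha2 : 0 < a + 2 := by linarith
  have ha1 : 0 < a + 1 := by linarith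
  rw [logIntegral_eq ha hni hw, ← pFq_sin ha hw, ← pFq_cos ha hw, ← pFq_gamma hni hw, hwr (a + 2),
    hwr (a + 1), hw2, capacityFormula, harg, hw2, hp, hG', logb,
    show (a + 2) / 2 = a / 2 + 1 by ring, add_comm 2 a]
  generalize pFq _ _ _ = F1
  generalize pFq _ _ _ = F2
  generalize pFq _ _ _ = F3
  have e1 := rpow_pos_of_pos hb (a + 2)
  have e2 := rpow_pos_of_pos hb (a + 1)
  have e3 := rpow_pos_of_pos hρ (a / 2 + 1)
  have e4 := rpow_pos_of_pos hρ ((a + 1) / 2)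
  generalize b ^ (a + 2) = B2 at *
  generalize b ^ (a + 1) = B1 at *
  generalize ρ ^ (a / 2 + 1) = R2 at *
  generalize ρ ^ ((a + 1) / 2) = R1 at *
  generalize a ^ 2 - a = q at *
  field_simp
  ring

end

end RIS

theorem theorem1 {Ω : Type*} [MeasurableSpace Ω] (P : Measure Ω) [IsProbabilityMeasure P]
    (A : Ω → ℝ) :
    -- arbitrary shape and scale; the shape is not an integer, as `csc` and `sec` require
    (∀ a b ρ : ℝ, -1 < a → (∀ n : ℤ, a ≠ n) → 0 < b → 0 < ρ → RIS.HasChannelPDF P A a b →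
      Integrable (RIS.rate ρ A) P ∧
        RIS.ergodicCapacity P ρ A = RIS.capacityFormula a b ρ) ∧
    -- the system with `N` reflection units, transmission power `Pt` and noise variance `N₀`
    (∀ (N : ℕ) (Pt N₀ : ℝ), 1 ≤ N → 0 < Pt → 0 < N₀ →
      RIS.HasChannelPDF P A (RIS.shape N) (RIS.scale N) →
      (∀ n : ℤ, RIS.shape N ≠ n) ∧
      Integrable (RIS.rate (Pt / N₀) A) P ∧
        RIS.ergodicCapacity P (Pt / N₀) A =
          RIS.capacityFormula (RIS.shape N) (RIS.scale N) (Pt / N₀)) := by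
  have main : ∀ a b ρ : ℝ, -1 < a → (∀ n : ℤ, a ≠ n) → 0 < b → 0 < ρ →
      RIS.HasChannelPDF P A a b → Integrable (RIS.rate ρ A) P ∧
        RIS.ergodicCapacity P ρ A = RIS.capacityFormula a b ρ := by
    intro a b ρ ha hni hb hρ hA
    rw [RIS.capacityFormula_eq ha hni hb hρ]
    exact RIS.integrable_rate_and_capacity ha hb hρ hA
  refine ⟨main, fun N Pt N₀ hN hPt hN₀ hA => ⟨RIS.shape_ne_int hN, ?_⟩⟩
  exact main _ _ _ (RIS.neg_one_lt_shape hN) (RIS.shape_ne_int hN) (RIS.scale_pos hN)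
    (div_pos hPt hN₀) hA
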